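/- Let $\mathbb F=\mathbb F_q$ be a finite field, $l\ge 2$ and $0\le k\le l$ integers. For $N\in\mathbb N$ regard $\mathbb F^{Nl}=(\mathbb F^N)^l$ as shared by $l$ parties holding $N$ coordinates each. For a linear subspace $L\subset\mathbb F^{Nl}$ and a set $J\subset\{1,\dots,l\}$ let $L_J\subset L$ be the space of all vectors of $L$ whose coordinates held by parties outside $J$ vanish. For $j\ge0$ let $C^jL=\bigoplus_{|J|=j}L_J$, and let $\delta_j:C^jL\to C^{j+1}L$ be given by $(\delta_j x)_B=\sum_{b\in B}(-1)^{\#\{c\in B:\,c<b\}}\,x_{B\setminus\{b\}}$. Then $\delta_{j+1}\delta_j=0$; put $H^jL=\ker\delta_j/\operatorname{im}\delta_{j-1}$ (with $\delta_{-1}=0$). Theorem 1. Let $\mathfrak G_k(N)$ be the set of all $Nk$-dimensional linear subspaces of $\mathbb F^{Nl}$, equipped with the uniform probability measure $P$, and let $L\in\mathfrak G_k(N)$ be a sample. Let $j\ge 0$ be an integer. 1. If $j<l-k$ then $\lim_{N\to\infty}P(C^jL\ne0)=0$. 2. If $j<l-k$ or $j>l-k+2$ then $\lim_{N\to\infty}P(H^jL\ne0)=0$.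 Let moreover a real $\varepsilon>0$ be given. Then 3. $\lim_{N\to\infty}P\left(\frac1N\dim C^{l-k}L\ge\varepsilon\right)=0$; 4. $\lim_{N\to\infty}P\left(\frac1N\dim H^{l-k}L+\frac1N\dim H^{l-k+2}L\ge\varepsilon\right)=0$; 5. $\lim_{N\to\infty}P\left(\frac1N\dim H^jL\ge\varepsilon\right)=0$ if $j\ne l-k+1$, and $$\lim_{N\to\infty}P\left(\left|\tfrac1N\dim H^{l-k+1}L-\chi_k\right|\ge\varepsilon\right)=0,$$ where $\chi_0=0$ and $\chi_k=\binom{l-2}{k-1}$ for $k>0$. -/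

import Mathlib

namespace StabilizerHomology

open Module

/-- `𝔽^{Nl}`: the standard space of `l` parties, each of which holds `N` coordinates. The
coordinate with index `(i, a)` is held by party `i`. -/
abbrev Space (F : Type*) (l N : ℕ) : Type _ := Fin l × Fin N → F

section Complex

variable {F : Type*} [Field F] {l N : ℕ}

/-- The vectors of `L` that are local to the set `J` of parties, that is, whose coordinates
held by parties outside `J` vanish. -/
def localPart (L : Submodule F (Space F l N)) (J : Finset (Fin l)) :
    Submodule F (Space F l N) where
  carrier := {v | v ∈ L ∧ ∀ p, p.1 ∉ J → v p = 0}
  add_mem' := by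
    rintro v w ⟨hv, hv'⟩ ⟨hw, hw'⟩
    exact ⟨L.add_mem hv hw, fun i hi => by simp [hv' i hi, hw' i hi]⟩
  zero_mem' := ⟨L.zero_mem, fun _ _ => rfl⟩
  smul_mem' := by
    rintro a v ⟨hv, hv'⟩
    exact ⟨L.smul_mem a hv, fun i hi => by simp [hv' i hi]⟩

/-- The `j`-element sets of parties. -/
abbrev Parties (l j : ℕ) : Type := {J : Finset (Fin l) // J.card = j}

/-- The chain group `C^j L`: the direct sum, over all `j`-element sets `J` of parties, of the
spaces of vectors of `L` that are local to `J`. It consists of the families `(x_J)` with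
`x_J ∈ L` local to `J`. -/
def Chain (L : Submodule F (Space F l N)) (j : ℕ) : Submodule F (Parties l j → Space F l N) :=
  Submodule.pi Set.univ fun J => localPart L J.1

theorem card_erase_of_card {j : ℕ} (B : Parties l (j + 1)) (b : {b // b ∈ B.1}) :
    (B.1.erase b.1).card = j := by
  rw [Finset.card_erase_of_mem b.2, B.2, Nat.add_sub_cancel]

variable (F l N) in
/-- The coboundary operator on arbitrary families of vectors indexed by `j`-element sets:
`(δ x)_B = ∑_{b ∈ B} (-1)^{#{c ∈ B | c < b}} x_{B \ {b}}`. -/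
def coboundary (j : ℕ) :
    (Parties l j → Space F l N) →ₗ[F] (Parties l (j + 1) → Space F l N) where
  toFun x B := ∑ b : {b // b ∈ B.1}, (-1 : F) ^ (B.1.filter (· < b.1)).card •
    x ⟨B.1.erase b.1, card_erase_of_card B b⟩
  map_add' x y := by
    funext B
    simp [Finset.sum_add_distrib]
  map_smul' a x := by
    funext B
    simp only [Pi.smul_apply, RingHom.id_apply, Finset.smul_sum (N := Space F l N)]
    exact Finset.sum_congr rfl fun b _ => smul_comm _ _ _

theorem coboundary_mem (L : Submodule F (Space F l N)) (j : ℕ)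
    (x : Parties l j → Space F l N) (hx : x ∈ Chain L j) :
    coboundary F l N j x ∈ Chain L (j + 1) := by
  intro B _
  refine Submodule.sum_mem _ fun b _ => Submodule.smul_mem _ _ ?_
  have h := hx ⟨B.1.erase b.1, card_erase_of_card B b⟩ trivial
  exact ⟨h.1, fun i hi => h.2 i fun hB => hi (Finset.erase_subset _ _ hB)⟩

theorem sign_swap (B : Finset (Fin l)) {b c : Fin l} (hb : b ∈ B) (h : b < c) :
    (-1 : F) ^ (B.filter (· < b)).card * (-1 : F) ^ ((B.erase b).filter (· < c)).card +
      (-1 : F) ^ (B.filter (· < c)).card * (-1 : F) ^ ((B.erase c).filter (· < b)).card = 0 := by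
  have h1 : (B.erase c).filter (· < b) = B.filter (· < b) := by
    ext i
    simp only [Finset.mem_filter, Finset.mem_erase]
    constructor
    · tauto
    · rintro ⟨hi, hib⟩
      exact ⟨⟨(hib.trans h).ne, hi⟩, hib⟩
  have h2 : (B.erase b).filter (· < c) = (B.filter (· < c)).erase b := by
    ext i
    simp only [Finset.mem_filter, Finset.mem_erase]
    tauto
  have h3 : (B.filter (· < c)).card = ((B.filter (· < c)).erase b).card + 1 :=
    (Finset.card_erase_add_one (Finset.mem_filter.2 ⟨hb, h⟩)).symm
  rw [h1, h2, h3]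
  ring

theorem coboundary_apply (j : ℕ) (x : Parties l j → Space F l N)
    (y : Finset (Fin l) → Space F l N) (hy : ∀ J : Parties l j, y J.1 = x J)
    (B : Parties l (j + 1)) :
    coboundary F l N j x B =
      ∑ b ∈ B.1, (-1 : F) ^ (B.1.filter (· < b)).card • y (B.1.erase b) := by
  rw [← Finset.sum_coe_sort B.1]
  exact Finset.sum_congr rfl fun b _ => by rw [← hy]

theorem coboundary_coboundary (j : ℕ) (x : Parties l j → Space F l N) :
    coboundary F l N (j + 1) (coboundary F l N j x) = 0 := by
  classical
  funext B
  let y : Finset (Fin l) → Space F l N := fun J => if h : J.card = j then x ⟨J, h⟩ else 0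
  have hy : ∀ J : Parties l j, y J.1 = x J := fun J => by simp [y, J.2]
  let z : Finset (Fin l) → Space F l N := fun K =>
    ∑ c ∈ K, (-1 : F) ^ (K.filter (· < c)).card • y (K.erase c)
  have hz : ∀ K : Parties l (j + 1), z K.1 = coboundary F l N j x K :=
    fun K => (coboundary_apply j x y hy K).symm
  rw [coboundary_apply (j + 1) (coboundary F l N j x) z hz B]
  change _ = (0 : Space F l N)
  simp only [z, Finset.smul_sum, smul_smul]
  rw [Finset.sum_sigma']
  refine Finset.sum_involution (fun p _ => ⟨p.2, p.1⟩) ?_ ?_ ?_ ?_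
  · rintro ⟨b, c⟩ hp
    simp only [Finset.mem_sigma, Finset.mem_erase] at hp
    obtain ⟨hb, hcb, hc⟩ := hp
    simp only
    rw [Finset.erase_right_comm (a := c) (b := b), ← add_smul]
    rcases lt_or_gt_of_ne hcb with h | h
    · rw [add_comm, sign_swap B.1 hc h, zero_smul]
    · rw [sign_swap B.1 hb h, zero_smul]
  · rintro ⟨b, c⟩ hp _ heq
    simp only [Finset.mem_sigma, Finset.mem_erase] at hp
    exact hp.2.1 (by simpa using congrArg Sigma.fst heq)
  · rintro ⟨b, c⟩ hp
    simp only [Finset.mem_sigma, Finset.mem_erase] at hp ⊢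
    exact ⟨hp.2.2, fun h => hp.2.1 h.symm, hp.1⟩
  · rintro ⟨b, c⟩ _
    rfl

/-- The kernel of the differential `δ_j : C^j L → C^{j+1} L`, which is the restriction of the
coboundary operator. -/
def cocycles (L : Submodule F (Space F l N)) (j : ℕ) : Submodule F (Parties l j → Space F l N) :=
  Chain L j ⊓ LinearMap.ker (coboundary F l N j)

/-- The image of the differential `δ_{j-1} : C^{j-1} L → C^j L`, and `0` for `j = 0`. -/
def coboundaries (L : Submodule F (Space F l N)) :
    (j : ℕ) → Submodule F (Parties l j → Space F l N)
  | 0 => ⊥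
  | j + 1 => (Chain L j).map (coboundary F l N j)

theorem coboundaries_le_cocycles (L : Submodule F (Space F l N)) (j : ℕ) :
    coboundaries L j ≤ cocycles L j := by
  cases j with
  | zero => exact bot_le
  | succ j =>
    rintro _ ⟨x, hx, rfl⟩
    exact ⟨coboundary_mem L j x hx, coboundary_coboundary j x⟩

/-- The homology group `H^j L = ker δ_j / image δ_{j-1}`. -/
abbrev Homology (L : Submodule F (Space F l N)) (j : ℕ) : Type _ :=
  cocycles L j ⧸ (coboundaries L j).submoduleOf (cocycles L j)

end Complex

section Probability

/-- The Grassmannian `𝔊_k(N)` of `Nk`-dimensional linear subspaces of `𝔽^{Nl}`. -/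
abbrev Gr (F : Type*) [Field F] (l k N : ℕ) : Type _ :=
  {L : Submodule F (Space F l N) // finrank F L = N * k}

/-- The uniform (Laplace) probability on the finite set `𝔊_k(N)`: favourable cases divided by
possible cases. -/
noncomputable def prob {F : Type*} [Field F] {l k N : ℕ} (A : Set (Gr F l k N)) : ℝ :=
  (Nat.card A : ℝ) / (Nat.card (Gr F l k N) : ℝ)

end Probability

/-- The expected normalised rank: `χ_0 = 0` and `χ_k = binom (l - 2) (k - 1)` for `k > 0`. -/
def chi (l k : ℕ) : ℕ := if k = 0 then 0 else (l - 2).choose (k - 1)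

end StabilizerHomology

namespace StabilizerHomology

open Module

/-! ### Signs and coordinatewise cones over the simplex of parties. -/

section Contraction

variable {F : Type*} [Field F] {l N : ℕ}

/-! Write `V` for the whole space, `V_J` for its vectors local to `J`, and let `p` be an
endomorphism of `V` with kernel `L` and range `Q`. Two complexes are exact: the chains of `⊤`, with
value `V_J` at `J`, and the constant complex with value `Q` at every `J`. Both are contracted by
coning (`coboundary_contraction`).

Applying `p` gives a short exact sequence from the chains of `L` through those of `⊤` onto their
image, and that image lies in the constant complex with a quotient of dimension `codim L j` in
degree `j`. The two connecting maps raise the degree by two, so `dim H^{j+2} L ≤ codim L j`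
(`finrank_homology_add_two_le`); trivially `dim H^j L ≤ dim C^j L`. Comparing ranks in the two exact
complexes, `dim H^{l-k+1} L` is `N χ_k` up to an error bounded by `dim C^{l-k} L` and `codim L
(l-k)` (`finrank_homology_middle`).

The rest is a first moment estimate. All nonzero vectors are equally likely to lie in a random `L`,
so the mean of `dim (L ∩ W)` is at most `q^(dim L + dim W - dim V)` (`sum_finrank_inf_mul_le`). This
bounds the mean of `dim C^j L` for `j ≤ l - k` and, through annihilators, the mean of `codim L j`
for `j ≥ l - k`: exponentially small off `j = l - k`, bounded there. Markov's inequality concludes;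
at `j = l - k` the factor `1/N` makes the bounded mean negligible. -/

theorem filter_lt_insert_self (B : Finset (Fin l)) (c : Fin l) :
    (insert c B).filter (· < c) = B.filter (· < c) := by
  rw [Finset.filter_insert, if_neg (lt_irrefl c)]

theorem filter_lt_erase_self (B : Finset (Fin l)) (c : Fin l) :
    (B.erase c).filter (· < c) = B.filter (· < c) := by
  ext i
  simp only [Finset.mem_filter, Finset.mem_erase]
  exact ⟨fun h => ⟨h.1.2, h.2⟩, fun h => ⟨⟨h.2.ne, h.1⟩, h.2⟩⟩

theorem neg_one_pow_mul_self (n : ℕ) : (-1 : F) ^ n * (-1 : F) ^ n = 1 := by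
  rw [← mul_pow]; simp

/-- The sign identity behind the contraction of the simplex with respect to a vertex. -/
theorem sign_insert (B : Finset (Fin l)) {b c : Fin l} (hb : b ∈ B) (hc : c ∉ B) :
    (-1 : F) ^ (B.filter (· < b)).card * (-1 : F) ^ ((B.erase b).filter (· < c)).card +
      (-1 : F) ^ (B.filter (· < c)).card * (-1 : F) ^ ((insert c B).filter (· < b)).card = 0 := by
  have hbc : b ≠ c := fun h => hc (h ▸ hb)
  have key : (-1 : F) ^ ((insert c B).filter (· < b)).card *
        (-1 : F) ^ (((insert c B).erase b).filter (· < c)).card +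
      (-1 : F) ^ ((insert c B).filter (· < c)).card *
        (-1 : F) ^ (((insert c B).erase c).filter (· < b)).card = 0 := by
    rcases lt_or_gt_of_ne hbc with h | h
    · exact sign_swap _ (Finset.mem_insert_of_mem hb) h
    · rw [add_comm]; exact sign_swap _ (Finset.mem_insert_self c B) h
  rw [Finset.erase_insert hc, Finset.erase_insert_of_ne hbc.symm, filter_lt_insert_self,
    filter_lt_insert_self] at key
  have h1 := neg_one_pow_mul_self (F := F) (B.filter (· < c)).card
  have h2 := neg_one_pow_mul_self (F := F) ((B.erase b).filter (· < c)).card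
  -- `key` is multiplied by the two signs counting elements below `c`; their squares are removed by
  -- `h1` and `h2`.
  linear_combination
    (-1 : F) ^ (B.filter (· < c)).card * (-1 : F) ^ ((B.erase b).filter (· < c)).card * key
    - (-1 : F) ^ (B.filter (· < b)).card * (-1 : F) ^ ((B.erase b).filter (· < c)).card * h1
    - (-1 : F) ^ (B.filter (· < c)).card * (-1 : F) ^ ((insert c B).filter (· < b)).card * h2

/-- The cone construction with vertex `c` contracts the augmented cochain complex of a simplex. -/
theorem contraction_identity (c : Fin l) (y : Finset (Fin l) → F) (B : Finset (Fin l)) :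
    (∑ b ∈ B, (-1 : F) ^ (B.filter (· < b)).card *
      (if c ∈ B.erase b then 0 else
        (-1 : F) ^ ((B.erase b).filter (· < c)).card * y (insert c (B.erase b)))) +
    (if c ∈ B then 0 else (-1 : F) ^ (B.filter (· < c)).card *
      ∑ b ∈ insert c B, (-1 : F) ^ ((insert c B).filter (· < b)).card *
        y ((insert c B).erase b)) = y B := by
  by_cases hc : c ∈ B
  · rw [if_pos hc, add_zero, Finset.sum_eq_single_of_mem c hc]
    · rw [if_neg (Finset.notMem_erase c B), filter_lt_erase_self, Finset.insert_erase hc,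
        ← mul_assoc, neg_one_pow_mul_self, one_mul]
    · intro b _ hbc
      rw [if_pos (Finset.mem_erase.2 ⟨hbc.symm, hc⟩), mul_zero]
  · rw [if_neg hc, Finset.sum_insert hc, mul_add, filter_lt_insert_self, Finset.erase_insert hc,
      ← mul_assoc, neg_one_pow_mul_self, one_mul, add_left_comm, Finset.mul_sum,
      ← Finset.sum_add_distrib, Finset.sum_eq_zero, add_zero]
    intro b hb
    have hbc : c ≠ b := fun h => hc (h ▸ hb)
    rw [if_neg fun h => hc (Finset.mem_of_mem_erase h), Finset.erase_insert_of_ne hbc]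
    linear_combination y (insert c (B.erase b)) * sign_insert (F := F) B hb hc

/-- The cone construction on families of vectors, where the vertex may depend on the party. -/
def contraction (c : Fin l → Fin l) {j : ℕ} (x : Parties l (j + 1) → Space F l N) :
    Parties l j → Space F l N := fun J p =>
  if h : c p.1 ∈ J.1 then 0 else (-1 : F) ^ (J.1.filter (· < c p.1)).card *
    x ⟨insert (c p.1) J.1, by rw [Finset.card_insert_of_notMem h, J.2]⟩ p

theorem coboundary_contraction (c : Fin l → Fin l) {j : ℕ} (x : Parties l (j + 1) → Space F l N)
    (hx : coboundary F l N (j + 1) x = 0) : coboundary F l N j (contraction c x) = x := by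
  funext B
  let y : Finset (Fin l) → Space F l N := fun J => if h : J.card = j + 1 then x ⟨J, h⟩ else 0
  have hy : ∀ J : Parties l (j + 1), y J.1 = x J := fun J => by simp [y, J.2]
  let z : Finset (Fin l) → Space F l N := fun J p =>
    if c p.1 ∈ J then 0 else (-1 : F) ^ (J.filter (· < c p.1)).card * y (insert (c p.1) J) p
  have hz : ∀ J : Parties l j, z J.1 = contraction c x J := by
    intro J
    funext p
    simp only [z, contraction]
    split_ifs with h
    · rfl
    · rw [← hy]
  rw [coboundary_apply j _ z hz]
  funext p
  have key := contraction_identity (c p.1) (fun J => y J p) B.1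
  -- In the homotopy identity `δh + hδ = id`, the term `hδ` vanishes on a cocycle.
  have h0 : (if c p.1 ∈ B.1 then 0 else (-1 : F) ^ (B.1.filter (· < c p.1)).card *
      ∑ b ∈ insert (c p.1) B.1, (-1 : F) ^ ((insert (c p.1) B.1).filter (· < b)).card *
        y ((insert (c p.1) B.1).erase b) p) = 0 := by
    split_ifs with h
    · rfl
    · have hB := congrFun (congrFun hx ⟨insert (c p.1) B.1,
        by rw [Finset.card_insert_of_notMem h, B.2]⟩) p
      rw [coboundary_apply _ x y hy] at hB
      simp only [Finset.sum_apply, Pi.smul_apply, smul_eq_mul, Pi.zero_apply] at hB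
      rw [hB, mul_zero]
  rw [h0, add_zero, hy] at key
  rw [Finset.sum_apply]
  exact key

theorem eq_zero_of_coboundary_zero (hl : 0 < l) (x : Parties l 0 → Space F l N)
    (hx : coboundary F l N 0 x = 0) : x = 0 := by
  have : ∀ J : Parties l 0, x J = x ⟨∅, rfl⟩ := fun J =>
    congrArg x (Subtype.ext (Finset.card_eq_zero.1 J.2))
  have h := congrFun hx ⟨{⟨0, hl⟩}, Finset.card_singleton _⟩
  rw [coboundary_apply 0 x (fun _ => x ⟨∅, rfl⟩) fun J => (this J).symm] at h
  funext J
  rw [this J]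
  simpa using h

theorem coboundary_compLeft (p : Space F l N →ₗ[F] Space F l N) {j : ℕ}
    (x : Parties l j → Space F l N) :
    coboundary F l N j (p.compLeft _ x) = p.compLeft _ (coboundary F l N j x) := by
  funext B
  simp [coboundary]

end Contraction

/-! ### Dimensions of kernels, images and chain groups. -/

section Rank

variable {F : Type*} [Field F] {l N : ℕ}

theorem finrank_map_add_finrank_inf_ker {V W : Type*} [AddCommGroup V] [Module F V]
    [FiniteDimensional F V] [AddCommGroup W] [Module F W] (f : V →ₗ[F] W) (A : Submodule F V) :
    finrank F (A.map f) + finrank F (A ⊓ LinearMap.ker f : Submodule F V) = finrank F A := by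
  have h := LinearMap.finrank_range_add_finrank_ker (f.domRestrict A)
  rw [LinearMap.range_domRestrict, LinearMap.ker_domRestrict] at h
  rw [← h, ← Submodule.map_comap_subtype, Submodule.finrank_map_subtype_eq]

theorem finrank_submodule_pi {ι V : Type*} [Fintype ι] [AddCommGroup V] [Module F V]
    [FiniteDimensional F V] (A : ι → Submodule F V) :
    finrank F (Submodule.pi Set.univ A) = ∑ i, finrank F (A i) := by
  rw [← Module.finrank_pi_fintype F]
  exact LinearEquiv.finrank_eq
    { toFun := fun x i => ⟨x.1 i, x.2 i trivial⟩
      invFun := fun x => ⟨fun i => x i, fun i _ => (x i).2⟩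
      map_add' := fun _ _ => rfl
      map_smul' := fun _ _ => rfl
      left_inv := fun _ => rfl
      right_inv := fun _ => rfl }

/-- Embedding `V ⧸ L` back into `V` lets the same `coboundary` serve chains with values in the
quotient. -/
theorem exists_linearMap_ker_eq {V : Type*} [AddCommGroup V] [Module F V] (L : Submodule F V) :
    ∃ p : V →ₗ[F] V, LinearMap.ker p = L := by
  obtain ⟨s, hs⟩ := L.mkQ.exists_rightInverse_of_surjective L.range_mkQ
  refine ⟨s ∘ₗ L.mkQ, ?_⟩
  rw [LinearMap.ker_comp_of_ker_eq_bot _ (LinearMap.ker_eq_bot_of_inverse hs), L.ker_mkQ]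

theorem finrank_localPart_top (J : Finset (Fin l)) :
    finrank F (localPart (⊤ : Submodule F (Space F l N)) J) = J.card * N := by
  have e : localPart (⊤ : Submodule F (Space F l N)) J ≃ₗ[F]
      ({p : Fin l × Fin N // p.1 ∈ J} → F) :=
    { toFun := fun v p => v.1 p.1
      invFun := fun w => ⟨fun p => if h : p.1 ∈ J then w ⟨p, h⟩ else 0,
        ⟨trivial, fun p hp => dif_neg hp⟩⟩
      map_add' := fun _ _ => rfl
      map_smul' := fun _ _ => rfl
      left_inv := by
        intro v
        ext p
        simp only
        split_ifs with h
        · rfl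
        · exact (v.2.2 p h).symm
      right_inv := by
        intro w
        funext p
        exact dif_pos p.2 }
  rw [e.finrank_eq, Module.finrank_fintype_fun_eq_card, Fintype.card_subtype]
  have : (Finset.univ.filter fun p : Fin l × Fin N => p.1 ∈ J) = J ×ˢ Finset.univ := by
    ext p; simp
  rw [this, Finset.card_product, Finset.card_univ, Fintype.card_fin]

theorem card_parties (j : ℕ) : Fintype.card (Parties l j) = l.choose j := by
  rw [Fintype.card_finset_len, Fintype.card_fin]

theorem finrank_chain_top (j : ℕ) :
    finrank F (Chain (⊤ : Submodule F (Space F l N)) j) = l.choose j * (j * N) := by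
  rw [Chain, finrank_submodule_pi, Finset.sum_congr rfl fun J _ => by
    rw [finrank_localPart_top, J.2], Finset.sum_const, Finset.card_univ, card_parties, smul_eq_mul]

end Rank

end StabilizerHomology

namespace StabilizerHomology

open Module

/-! ### Exactness and ranks of the two model complexes. -/

section Exactness

variable {F : Type*} [Field F] {l N : ℕ}

/-- Coordinates of party `i` are coned from a vertex `c i ≠ i`, available as `2 ≤ l`. Adding `c i`
to a set that misses `i` still misses `i`, so locality is preserved. -/
theorem map_coboundary_chain_top (hl : 2 ≤ l) (j : ℕ) :
    (Chain (⊤ : Submodule F (Space F l N)) j).map (coboundary F l N j) =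
      Chain ⊤ (j + 1) ⊓ LinearMap.ker (coboundary F l N (j + 1)) := by
  apply le_antisymm
  · rintro _ ⟨x, hx, rfl⟩
    exact ⟨coboundary_mem ⊤ j x hx, coboundary_coboundary j x⟩
  · rintro x ⟨hx, hx0⟩
    have hc : ∀ i : Fin l, ∃ c : Fin l, c ≠ i := fun i => by
      have : Nontrivial (Fin l) := Fin.nontrivial_iff_two_le.2 hl
      exact exists_ne i
    choose c hc using hc
    refine ⟨contraction c x, ?_, coboundary_contraction c x hx0⟩
    intro J _
    refine ⟨trivial, fun p hp => ?_⟩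
    simp only [contraction]
    split_ifs with h
    · rfl
    · rw [(hx ⟨insert (c p.1) J.1, _⟩ trivial).2 p, mul_zero]
      simp [hp, (hc p.1).symm]

theorem map_coboundary_pi_const (hl : 0 < l) (Q : Submodule F (Space F l N)) (j : ℕ) :
    (Submodule.pi Set.univ fun _ : Parties l j => Q).map (coboundary F l N j) =
      (Submodule.pi Set.univ fun _ : Parties l (j + 1) => Q) ⊓
        LinearMap.ker (coboundary F l N (j + 1)) := by
  apply le_antisymm
  · rintro _ ⟨x, hx, rfl⟩
    exact ⟨fun B _ => Submodule.sum_mem _ fun b _ => Submodule.smul_mem _ _ (hx _ trivial),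
      coboundary_coboundary j x⟩
  · rintro x ⟨hx, hx0⟩
    refine ⟨contraction (fun _ => ⟨0, hl⟩) x, ?_, coboundary_contraction _ x hx0⟩
    intro J _
    by_cases h : (⟨0, hl⟩ : Fin l) ∈ J.1
    · have : contraction (fun _ => ⟨0, hl⟩) x J = 0 := by
        funext p
        simp [contraction, h]
      rw [this]
      exact Q.zero_mem
    · have : contraction (fun _ => ⟨0, hl⟩) x J =
          (-1 : F) ^ (J.1.filter (· < ⟨0, hl⟩)).card • x ⟨insert ⟨0, hl⟩ J.1, by
            rw [Finset.card_insert_of_notMem h, J.2]⟩ := by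
        funext p
        simp [contraction, h]
      rw [this]
      exact Q.smul_mem _ (hx _ trivial)

theorem finrank_map_coboundary_chain_top_zero :
    finrank F ((Chain (⊤ : Submodule F (Space F l N)) 0).map (coboundary F l N 0)) = 0 := by
  have h := finrank_map_add_finrank_inf_ker (coboundary F l N 0) (Chain ⊤ 0)
  rw [finrank_chain_top] at h
  omega

theorem finrank_map_coboundary_chain_top (hl : 2 ≤ l) (j : ℕ) :
    finrank F ((Chain (⊤ : Submodule F (Space F l N)) (j + 1)).map (coboundary F l N (j + 1))) =
      l * N * (l - 2).choose j := by
  obtain ⟨n, rfl⟩ : ∃ n, l = n + 2 := ⟨l - 2, by omega⟩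
  rw [Nat.add_sub_cancel]
  induction j with
  | zero =>
    have h := finrank_map_add_finrank_inf_ker (coboundary F (n + 2) N 1) (Chain ⊤ 1)
    rw [← map_coboundary_chain_top hl, finrank_map_coboundary_chain_top_zero,
      finrank_chain_top] at h
    simpa using h
  | succ j ih =>
    have h := finrank_map_add_finrank_inf_ker (coboundary F (n + 2) N (j + 2)) (Chain ⊤ (j + 2))
    -- Absorption turns `(j+2) * choose (n+2) (j+2)` into `(n+2) * choose (n+1) (j+1)`; Pascal's
    -- rule then splits off the previous rank.
    rw [← map_coboundary_chain_top hl, ih, finrank_chain_top, ← mul_assoc,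
      ← Nat.add_one_mul_choose_eq (n + 1) (j + 1), Nat.choose_succ_succ n j] at h
    refine Nat.add_right_cancel (h.trans ?_)
    simp only [Nat.succ_eq_add_one]
    ring

theorem finrank_map_coboundary_pi_const (hl : 0 < l) (Q : Submodule F (Space F l N)) (j : ℕ) :
    finrank F ((Submodule.pi Set.univ fun _ : Parties l j => Q).map (coboundary F l N j)) =
      (l - 1).choose j * finrank F Q := by
  obtain ⟨n, rfl⟩ : ∃ n, l = n + 1 := ⟨l - 1, by omega⟩
  have hX : ∀ j, finrank F (Submodule.pi Set.univ fun _ : Parties (n + 1) j => Q) =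
      (n + 1).choose j * finrank F Q := fun j => by
    rw [finrank_submodule_pi, Finset.sum_const, Finset.card_univ, card_parties, smul_eq_mul]
  rw [Nat.add_sub_cancel]
  induction j with
  | zero =>
    have h := finrank_map_add_finrank_inf_ker (coboundary F (n + 1) N 0)
      (Submodule.pi Set.univ fun _ => Q)
    have h0 : (Submodule.pi Set.univ fun _ : Parties (n + 1) 0 => Q) ⊓
        LinearMap.ker (coboundary F (n + 1) N 0) = ⊥ :=
      (Submodule.eq_bot_iff _).2 fun x hx => eq_zero_of_coboundary_zero hl x hx.2
    rw [h0, finrank_bot, hX] at h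
    simpa using h
  | succ j ih =>
    have h := finrank_map_add_finrank_inf_ker (coboundary F (n + 1) N (j + 1))
      (Submodule.pi Set.univ fun _ => Q)
    rw [← map_coboundary_pi_const hl, ih, hX, Nat.choose_succ_succ, Nat.succ_eq_add_one] at h
    refine Nat.add_right_cancel (h.trans ?_)
    ring

end Exactness

/-! ### Homology bounded by `Chain` and `codim`. -/

section Bounds

variable {F : Type*} [Field F] {l N : ℕ}

/-- The total codimension of the spaces `V_J + L`, where `V_J` consists of all vectors local to
`J` and `J` runs over the `j`-element sets of parties. -/
noncomputable def codim (L : Submodule F (Space F l N)) (j : ℕ) : ℕ :=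
  ∑ J : Parties l j, finrank F (Space F l N ⧸ (localPart ⊤ J.1 ⊔ L))

theorem localPart_eq_inf (L : Submodule F (Space F l N)) (J : Finset (Fin l)) :
    localPart L J = localPart ⊤ J ⊓ L := by
  ext v
  exact ⟨fun h => ⟨⟨trivial, h.2⟩, h.1⟩, fun h => ⟨h.2, h.1.2⟩⟩

theorem chain_eq_inf_ker {L : Submodule F (Space F l N)} {p : Space F l N →ₗ[F] Space F l N}
    (hp : LinearMap.ker p = L) (j : ℕ) :
    Chain L j = Chain ⊤ j ⊓ LinearMap.ker (p.compLeft (Parties l j)) := by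
  ext x
  constructor
  · intro h
    refine ⟨fun J _ => ⟨trivial, (h J trivial).2⟩, funext fun J => ?_⟩
    have : x J ∈ LinearMap.ker p := hp ▸ (h J trivial).1
    exact this
  · rintro ⟨h, h'⟩ J -
    exact ⟨hp ▸ (congrFun h' J : p (x J) = 0), (h J trivial).2⟩

theorem finrank_codim {V : Type*} [AddCommGroup V] [Module F V] [FiniteDimensional F V]
    {L : Submodule F V} {p : V →ₗ[F] V} (hp : LinearMap.ker p = L) (W : Submodule F V) :
    finrank F (W.map p) + finrank F (V ⧸ (W ⊔ L)) = finrank F (LinearMap.range p) := by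
  have h1 := finrank_map_add_finrank_inf_ker p W
  have h2 := p.finrank_range_add_finrank_ker
  have h3 := Submodule.finrank_sup_add_finrank_inf_eq W L
  have h4 := Submodule.finrank_quotient_add_finrank (W ⊔ L)
  rw [hp] at h1 h2
  omega

variable {L : Submodule F (Space F l N)} {p : Space F l N →ₗ[F] Space F l N}

theorem map_compLeft_chain_le (j : ℕ) :
    (Chain (⊤ : Submodule F (Space F l N)) j).map (p.compLeft (Parties l j)) ≤
      Submodule.pi Set.univ fun _ => LinearMap.range p := by
  rintro _ ⟨x, _, rfl⟩ J -
  exact ⟨x J, rfl⟩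

theorem map_compLeft_chain_eq (j : ℕ) :
    (Chain (⊤ : Submodule F (Space F l N)) j).map (p.compLeft (Parties l j)) =
      Submodule.pi Set.univ fun J => (localPart ⊤ J.1).map p := by
  apply le_antisymm
  · rintro _ ⟨x, hx, rfl⟩ J -
    exact ⟨x J, hx J trivial, rfl⟩
  · intro y hy
    choose x hx hxy using fun J => hy J trivial
    exact ⟨x, fun J _ => hx J, funext hxy⟩

theorem finrank_pi_range (hp : LinearMap.ker p = L) (j : ℕ) :
    finrank F (Submodule.pi Set.univ fun _ : Parties l j => LinearMap.range p) =
      finrank F ((Chain (⊤ : Submodule F (Space F l N)) j).map (p.compLeft (Parties l j))) +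
        codim L j := by
  rw [map_compLeft_chain_eq, finrank_submodule_pi, finrank_submodule_pi, codim,
    ← Finset.sum_add_distrib]
  exact Finset.sum_congr rfl fun J _ => (finrank_codim hp _).symm

theorem finrank_map_compLeft_chain (hp : LinearMap.ker p = L) (j : ℕ) :
    finrank F ((Chain (⊤ : Submodule F (Space F l N)) j).map (p.compLeft (Parties l j))) +
      finrank F (Chain L j) = finrank F (Chain (⊤ : Submodule F (Space F l N)) j) := by
  rw [chain_eq_inf_ker hp]
  exact finrank_map_add_finrank_inf_ker _ _

/-- By exactness for `⊤`, cocycles of `L` are the coboundaries of `⊤` killed by `p`; since `p`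
commutes with `coboundary`, rank–nullity applies. -/
theorem finrank_cocycles_succ (hl : 2 ≤ l) (hp : LinearMap.ker p = L) (j : ℕ) :
    finrank F (cocycles L (j + 1)) +
      finrank F (((Chain ⊤ j).map (p.compLeft (Parties l j))).map (coboundary F l N j)) =
    finrank F ((Chain (⊤ : Submodule F (Space F l N)) j).map (coboundary F l N j)) := by
  have h : cocycles L (j + 1) = (Chain ⊤ j).map (coboundary F l N j) ⊓
      LinearMap.ker (p.compLeft (Parties l (j + 1))) := by
    rw [map_coboundary_chain_top hl, cocycles, chain_eq_inf_ker hp, inf_right_comm]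
  have h' : ((Chain ⊤ j).map (p.compLeft (Parties l j))).map (coboundary F l N j) =
      ((Chain ⊤ j).map (coboundary F l N j)).map (p.compLeft (Parties l (j + 1))) := by
    rw [← Submodule.map_comp, ← Submodule.map_comp]
    congr 1
    exact LinearMap.ext fun x => coboundary_compLeft p x
  rw [h, h', add_comm]
  exact finrank_map_add_finrank_inf_ker _ _

theorem finrank_homology (L : Submodule F (Space F l N)) (j : ℕ) :
    finrank F (Homology L j) + finrank F (coboundaries L j) = finrank F (cocycles L j) := by
  rw [← (Submodule.submoduleOfEquivOfLe (coboundaries_le_cocycles L j)).finrank_eq]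
  exact Submodule.finrank_quotient_add_finrank _

theorem finrank_coboundaries_succ (L : Submodule F (Space F l N)) (j : ℕ) :
    finrank F (coboundaries L (j + 1)) + finrank F (cocycles L j) = finrank F (Chain L j) :=
  finrank_map_add_finrank_inf_ker _ _

theorem finrank_homology_le_chain (L : Submodule F (Space F l N)) (j : ℕ) :
    finrank F (Homology L j) ≤ finrank F (Chain L j) := by
  have h1 := finrank_homology L j
  have h2 : finrank F (cocycles L j) ≤ finrank F (Chain L j) :=
    Submodule.finrank_mono inf_le_left
  omega

/-- The double connecting map in terms of ranks: `H^{j+2} L` is the homology of the `p`-image in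
degree `j + 1`, whose cocycles are coboundaries of constant chains (`h8`); those not coming from the
`p`-image number at most `codim L j` dimensions (`h12`). -/
theorem finrank_homology_add_two_le (hl : 2 ≤ l) (L : Submodule F (Space F l N)) (j : ℕ) :
    finrank F (Homology L (j + 2)) ≤ codim L j := by
  change finrank F (Homology L (j + 1 + 1)) ≤ codim L j
  obtain ⟨p, hp⟩ := exists_linearMap_ker_eq L
  have h1 := finrank_homology L (j + 1 + 1)
  have h2 := finrank_coboundaries_succ L (j + 1)
  have h3 := finrank_cocycles_succ hl hp j
  have h4 := finrank_cocycles_succ hl hp (j + 1)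
  have h5 := finrank_map_compLeft_chain hp (j + 1)
  have h6 := finrank_map_add_finrank_inf_ker (coboundary F l N (j + 1))
    ((Chain ⊤ (j + 1)).map (p.compLeft (Parties l (j + 1))))
  have h7 := finrank_map_add_finrank_inf_ker (coboundary F l N (j + 1)) (Chain ⊤ (j + 1))
  rw [← map_coboundary_chain_top hl] at h7
  have h8 : finrank F (((Chain ⊤ (j + 1)).map (p.compLeft (Parties l (j + 1)))) ⊓
      LinearMap.ker (coboundary F l N (j + 1)) : Submodule F (Parties l (j + 1) → Space F l N)) ≤
      finrank F ((Submodule.pi Set.univ fun _ : Parties l j => LinearMap.range p).map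
        (coboundary F l N j)) := by
    rw [map_coboundary_pi_const (by omega)]
    exact Submodule.finrank_mono (inf_le_inf_right _ (map_compLeft_chain_le _))
  have h9 := finrank_map_add_finrank_inf_ker (coboundary F l N j)
    (Submodule.pi Set.univ fun _ : Parties l j => LinearMap.range p)
  have h10 := finrank_map_add_finrank_inf_ker (coboundary F l N j)
    ((Chain ⊤ j).map (p.compLeft (Parties l j)))
  have h11 := finrank_pi_range hp j
  have h12 : finrank F (((Chain ⊤ j).map (p.compLeft (Parties l j))) ⊓
      LinearMap.ker (coboundary F l N j) : Submodule F (Parties l j → Space F l N)) ≤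
      finrank F ((Submodule.pi Set.univ fun _ : Parties l j => LinearMap.range p) ⊓
        LinearMap.ker (coboundary F l N j) : Submodule F (Parties l j → Space F l N)) :=
    Submodule.finrank_mono (inf_le_inf_right _ (map_compLeft_chain_le _))
  omega

theorem chi_identity {l k : ℕ} (hl : 2 ≤ l) (hk : k ≤ l) (N m : ℕ) (hm : m + 1 = l - k) :
    l * N * (l - 2).choose m = (l - 1).choose (m + 1) * (N * (m + 1)) + N * chi l k := by
  obtain ⟨n, rfl⟩ : ∃ n, l = n + 2 := ⟨l - 2, by omega⟩
  have hchi : chi (n + 2) k = n.choose m := by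
    unfold chi
    split_ifs with h
    · rw [Nat.choose_eq_zero_of_lt (by omega)]
    · rw [Nat.add_sub_cancel]
      exact Nat.choose_symm_of_eq_add (by omega)
  have h := Nat.add_one_mul_choose_eq n m
  rw [hchi, Nat.add_sub_cancel, show n + 2 - 1 = n + 1 by omega]
  calc (n + 2) * N * n.choose m = N * ((n + 1) * n.choose m) + N * n.choose m := by ring
    _ = _ := by rw [h]; ring

/-- The homology in the middle degree differs from `N χ_k` by at most small terms. -/
theorem finrank_homology_middle {k : ℕ} (hl : 2 ≤ l) (hk : k ≤ l)
    (L : Submodule F (Space F l N)) (hL : finrank F L = N * k) :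
    N * chi l k ≤ finrank F (Homology L (l - k + 1)) + finrank F (Chain L (l - k)) ∧
      finrank F (Homology L (l - k + 1)) ≤ N * chi l k + codim L (l - k) := by
  obtain ⟨p, hp⟩ := exists_linearMap_ker_eq L
  obtain ⟨m, hm⟩ : ∃ m, m = l - k := ⟨_, rfl⟩
  have hQ : finrank F (LinearMap.range p) = N * m := by
    have h := p.finrank_range_add_finrank_ker
    rw [hp, hL, Module.finrank_fintype_fun_eq_card, Fintype.card_prod, Fintype.card_fin,
      Fintype.card_fin] at h
    have : l * N = N * m + N * k := by rw [← mul_add, mul_comm]; congr 1; omega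
    omega
  have hV : finrank F ((Chain (⊤ : Submodule F (Space F l N)) m).map (coboundary F l N m)) =
      (l - 1).choose m * (N * m) + N * chi l k := by
    -- The rank formula for `⊤` starts in degree one; `m = 0` means `k = l`, where `χ_k = 0`.
    cases m with
    | zero =>
      have hc : chi l k = 0 := by
        unfold chi
        rw [if_neg (by omega), Nat.choose_eq_zero_of_lt (by omega)]
      rw [finrank_map_coboundary_chain_top_zero, hc]
      simp
    | succ m => rw [finrank_map_coboundary_chain_top hl, chi_identity hl hk N m hm]
  have h1 := finrank_homology L (m + 1)
  have h2 := finrank_coboundaries_succ L m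
  have h3 := finrank_cocycles_succ hl hp m
  have h4 := finrank_map_coboundary_pi_const (by omega) (LinearMap.range p) m
  have h5 := finrank_map_add_finrank_inf_ker (coboundary F l N m)
    (Submodule.pi Set.univ fun _ : Parties l m => LinearMap.range p)
  have h6 := finrank_map_add_finrank_inf_ker (coboundary F l N m)
    ((Chain ⊤ m).map (p.compLeft (Parties l m)))
  have h7 := finrank_pi_range hp m
  have h8 : finrank F (((Chain ⊤ m).map (p.compLeft (Parties l m))) ⊓
      LinearMap.ker (coboundary F l N m) : Submodule F (Parties l m → Space F l N)) ≤
      finrank F ((Submodule.pi Set.univ fun _ : Parties l m => LinearMap.range p) ⊓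
        LinearMap.ker (coboundary F l N m) : Submodule F (Parties l m → Space F l N)) :=
    Submodule.finrank_mono (inf_le_inf_right _ (map_compLeft_chain_le _))
  have h9 : finrank F (((Chain ⊤ m).map (p.compLeft (Parties l m))).map (coboundary F l N m)) ≤
      finrank F ((Submodule.pi Set.univ fun _ : Parties l m => LinearMap.range p).map
        (coboundary F l N m)) :=
    Submodule.finrank_mono (Submodule.map_mono (map_compLeft_chain_le _))
  rw [hQ] at h4
  rw [← hm]
  constructor <;> omega

end Bounds

end StabilizerHomology

namespace StabilizerHomology

open Module

/-! ### Mean dimension of an intersection. -/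

section Counting

/-- Double counting for a relation whose columns are permuted transitively by symmetries. -/
theorem sum_card_filter_mul_card {X Y : Type*} [Fintype X] [Fintype Y] (R : X → Y → Prop)
    [∀ x y, Decidable (R x y)] (hR : ∀ y y', ∃ e : X ≃ X, ∀ x, R x y ↔ R (e x) y') {r : ℕ}
    (hr : ∀ x, (Finset.univ.filter fun y => R x y).card = r) (T : Finset Y) :
    (∑ x, (T.filter fun y => R x y).card) * Fintype.card Y = T.card * (r * Fintype.card X) := by
  have hswap : ∀ S : Finset Y, ∑ x, (S.filter fun y => R x y).card =
      ∑ y ∈ S, (Finset.univ.filter fun x => R x y).card := fun S =>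
    Finset.sum_card_bipartiteAbove_eq_sum_card_bipartiteBelow R
  have hconst : ∀ y y', (Finset.univ.filter fun x => R x y).card =
      (Finset.univ.filter fun x => R x y').card := fun y y' => by
    obtain ⟨e, he⟩ := hR y y'
    refine Finset.card_bij (fun x _ => e x) ?_ ?_ ?_
    · intro x hx
      simpa [← he] using hx
    · intro x _ x' _ h
      exact e.injective h
    · intro x hx
      exact ⟨e.symm x, by simpa [he] using hx, e.apply_symm_apply x⟩
  rcases isEmpty_or_nonempty Y with hY | ⟨⟨y₀⟩⟩
  · simp [Finset.eq_empty_of_isEmpty T]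
  · have hall := hswap Finset.univ
    rw [hswap T, Finset.sum_congr rfl fun y _ => hconst y y₀, Finset.sum_const, smul_eq_mul,
      mul_assoc]
    rw [Finset.sum_congr rfl fun y _ => hconst y y₀, Finset.sum_const,
      Finset.sum_congr rfl fun x _ => hr x, Finset.sum_const, Finset.card_univ, Finset.card_univ,
      smul_eq_mul, smul_eq_mul] at hall
    rw [mul_comm r, hall, mul_comm (Fintype.card Y)]

variable {F U : Type*} [Field F] [AddCommGroup U] [Module F U] [FiniteDimensional F U]

open Classical in
theorem card_filter_nonzero_mem [Fintype U] (S : Submodule F U) :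
    (Finset.univ.filter fun u : {u : U // u ≠ 0} => u.1 ∈ S).card =
      Nat.card F ^ finrank F S - 1 := by
  have h1 : ((Finset.univ.filter fun u : {u : U // u ≠ 0} => u.1 ∈ S).map
      (Function.Embedding.subtype _)) = (Finset.univ.filter fun u : U => u ∈ S).erase 0 := by
    ext u
    simp [and_comm]
  have h2 : (Finset.univ.filter fun u : U => u ∈ S).card = Nat.card F ^ finrank F S := by
    rw [← Module.natCard_eq_pow_finrank (K := F), Nat.card_eq_fintype_card, Fintype.card_subtype]
  rw [← Finset.card_map, h1, Finset.card_erase_of_mem (by simp), h2]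

/-- A dimension is at most the number of nonzero vectors. By transitivity each nonzero vector lies
in `S x` with frequency `(q^d - 1) / (q^u - 1)`, `u = dim U`, and this is at most `q^d / q^u`. -/
theorem sum_finrank_inf_mul_le [Finite F] {X : Type*} [Fintype X] (S : X → Submodule F U) {d : ℕ}
    (hd : ∀ x, finrank F (S x) = d)
    (hS : ∀ u u' : U, u ≠ 0 → u' ≠ 0 → ∃ e : X ≃ X, ∀ x, u ∈ S x ↔ u' ∈ S (e x))
    (W : Submodule F U) :
    (∑ x, finrank F (S x ⊓ W : Submodule F U)) * Nat.card F ^ finrank F U ≤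
      Nat.card F ^ finrank F W * Nat.card F ^ d * Fintype.card X := by
  classical
  have : Finite U := Module.finite_of_finite F
  have := Fintype.ofFinite U
  have hq : 1 < Nat.card F := Finite.one_lt_card
  set q := Nat.card F with hqdef
  rcases Nat.eq_zero_or_pos (finrank F U) with hU | hU
  · rw [Finset.sum_eq_zero, zero_mul]
    · exact Nat.zero_le _
    · intro x _
      exact Nat.le_zero.1 (hU ▸ Submodule.finrank_le _)
  have key := sum_card_filter_mul_card (fun x (u : {u : U // u ≠ 0}) => u.1 ∈ S x)
    (fun u u' => hS u.1 u'.1 u.2 u'.2) (r := q ^ d - 1)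
    (fun x => by rw [card_filter_nonzero_mem, hd]) (Finset.univ.filter fun u => u.1 ∈ W)
  have hY : Fintype.card {u : U // u ≠ 0} = q ^ finrank F U - 1 := by
    have h := card_filter_nonzero_mem (⊤ : Submodule F U)
    rw [finrank_top] at h
    rw [← h]
    simp
  rw [hY, card_filter_nonzero_mem] at key
  have hle : ∑ x, finrank F (S x ⊓ W : Submodule F U) ≤ ∑ x, ((Finset.univ.filter
      fun u : {u : U // u ≠ 0} => u.1 ∈ W).filter fun u => u.1 ∈ S x).card := by
    refine Finset.sum_le_sum fun x _ => ?_
    have h := card_filter_nonzero_mem (S x ⊓ W)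
    rw [Finset.filter_filter]
    simp only [Submodule.mem_inf, and_comm] at h ⊢
    rw [h]
    exact Nat.le_sub_one_of_lt (Nat.lt_pow_self hq)
  refine (Nat.mul_le_mul_right _ hle).trans ?_
  -- `d` is constrained only when `X` is nonempty; otherwise both sides vanish.
  have hdU : d ≤ finrank F U ∨ Fintype.card X = 0 := by
    rcases isEmpty_or_nonempty X with h | ⟨⟨x⟩⟩
    · exact Or.inr Fintype.card_eq_zero
    · exact Or.inl (hd x ▸ Submodule.finrank_le _)
  rcases hdU with hdU | hX
  · obtain ⟨a, ha⟩ : ∃ a, q ^ finrank F U = a + 1 := ⟨_, (Nat.sub_add_cancel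
      (Nat.one_le_pow _ _ hq.le)).symm⟩
    obtain ⟨b, hb⟩ : ∃ b, q ^ finrank F W = b + 1 := ⟨_, (Nat.sub_add_cancel
      (Nat.one_le_pow _ _ hq.le)).symm⟩
    obtain ⟨c, hc⟩ : ∃ c, q ^ d = c + 1 := ⟨_, (Nat.sub_add_cancel
      (Nat.one_le_pow _ _ hq.le)).symm⟩
    have hca : c ≤ a := by
      have := Nat.pow_le_pow_right hq.le hdU
      omega
    have ha0 : 0 < a := by
      have := Nat.one_lt_pow hU.ne' hq
      omega
    rw [ha, hb, hc, Nat.add_sub_cancel, Nat.add_sub_cancel, Nat.add_sub_cancel] at key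
    rw [ha, hb, hc]
    refine Nat.le_of_mul_le_mul_left ?_ ha0
    calc _ = (b * (c * Fintype.card X)) * (a + 1) := by rw [← key]; ring
      _ = (b * c * a + b * c) * Fintype.card X := by ring
      _ ≤ (b * c * a + b * a) * Fintype.card X :=
        Nat.mul_le_mul_right _ (Nat.add_le_add_left (Nat.mul_le_mul_left _ hca) _)
      _ ≤ (b * c * a + b * a + (c * a + a)) * Fintype.card X :=
        Nat.mul_le_mul_right _ (Nat.le_add_right _ _)
      _ = _ := by ring
  · have := Fintype.card_eq_zero_iff.1 hX
    simp

end Counting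

/-! ### Transitivity of the linear group on nonzero functionals and vectors. -/

section Transitivity

variable {F V : Type*} [Field F] [AddCommGroup V] [Module F V]

/-- A vector space is never the union of two proper subspaces. -/
theorem exists_apply_ne_zero_pair {f g : Dual F V} (hf : f ≠ 0) (hg : g ≠ 0) :
    ∃ v, f v ≠ 0 ∧ g v ≠ 0 := by
  obtain ⟨v, hv⟩ := DFunLike.ne_iff.1 hf
  obtain ⟨w, hw⟩ := DFunLike.ne_iff.1 hg
  rw [LinearMap.zero_apply] at hv hw
  by_cases h1 : g v = 0
  · by_cases h2 : f w = 0
    · exact ⟨v + w, by simpa [h2] using hv, by simpa [h1] using hw⟩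
    · exact ⟨w, h2, hw⟩
  · exact ⟨v, hv, h1⟩

theorem exists_linearEquiv_comp_eq {f g : Dual F V} (hf : f ≠ 0) (hg : g ≠ 0) :
    ∃ e : V ≃ₗ[F] V, ∀ x, g (e x) = f x := by
  obtain ⟨v, hfv, hgv⟩ := exists_apply_ne_zero_pair hf hg
  have hu : IsUnit (1 + (f - g) ((g v)⁻¹ • v)) := by
    rw [isUnit_iff_ne_zero]
    simpa [mul_sub, hgv] using hfv
  -- The map is `x ↦ x + (f - g) x • (g v)⁻¹ • v`; the unit in `hu` equals `f v / g v`.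
  refine ⟨LinearEquiv.dilatransvection hu, fun x => ?_⟩
  rw [LinearEquiv.dilatransvection.apply]
  simp [hgv]

theorem exists_linearEquiv_apply_eq {v w : V} (hv : v ≠ 0) (hw : w ≠ 0) :
    ∃ e : V ≃ₗ[F] V, e v = w := by
  obtain ⟨f, hfv, hfw⟩ := exists_apply_ne_zero_pair
    (f := Dual.eval F V v) (g := Dual.eval F V w)
    (fun h => hv ((Module.eval_apply_eq_zero_iff F v).1 h))
    (fun h => hw ((Module.eval_apply_eq_zero_iff F w).1 h))
  rw [Dual.eval_apply] at hfv hfw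
  have hu : IsUnit (1 + ((f v)⁻¹ • f) (w - v)) := by
    rw [isUnit_iff_ne_zero]
    simpa [mul_sub, hfv] using hfw
  -- The map is `x ↦ x + (f x / f v) • (w - v)`; the unit in `hu` equals `f w / f v`.
  refine ⟨LinearEquiv.dilatransvection hu, ?_⟩
  rw [LinearEquiv.dilatransvection.apply]
  simp [hfv]

end Transitivity

/-! ### First moments on the Grassmannian. -/

section Grassmannian

variable {F : Type*} [Field F] {l k N : ℕ}

theorem finrank_space : finrank F (Space F l N) = N * l := by
  rw [Module.finrank_fintype_fun_eq_card, Fintype.card_prod, Fintype.card_fin, Fintype.card_fin,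
    mul_comm]

/-- The action of a linear automorphism on the Grassmannian. -/
def grEquiv (g : Space F l N ≃ₗ[F] Space F l N) : Gr F l k N ≃ Gr F l k N :=
  (Submodule.orderIsoMapComap g).toEquiv.subtypeEquiv fun L => by
    change _ ↔ finrank F (L.map (g : Space F l N →ₗ[F] Space F l N)) = _
    rw [LinearEquiv.finrank_map_eq]

theorem mem_grEquiv (g : Space F l N ≃ₗ[F] Space F l N) (L : Gr F l k N) (v : Space F l N) :
    g v ∈ (grEquiv g L).1 ↔ v ∈ L.1 := by
  change g v ∈ L.1.map (g : Space F l N →ₗ[F] Space F l N) ↔ _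
  rw [Submodule.mem_map]
  exact ⟨fun ⟨w, hw, h⟩ => g.injective h ▸ hw, fun h => ⟨v, h, rfl⟩⟩

variable [Finite F]

instance : Finite (Gr F l k N) :=
  Finite.of_injective (fun L => (L.1 : Set (Space F l N)))
    fun _ _ h => Subtype.ext (SetLike.coe_injective h)

theorem sum_finrank_chain_mul_le [Fintype (Gr F l k N)] {j t : ℕ} (h : j + k + t = l) :
    (∑ L : Gr F l k N, finrank F (Chain L.1 j)) * Nat.card F ^ (N * t) ≤
      l.choose j * Fintype.card (Gr F l k N) := by
  have hq : 0 < Nat.card F := Nat.card_pos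
  have hJ : ∀ J : Parties l j, (∑ L : Gr F l k N, finrank F (localPart L.1 J.1)) *
      Nat.card F ^ (N * t) ≤ Fintype.card (Gr F l k N) := by
    intro J
    have key := sum_finrank_inf_mul_le (fun L : Gr F l k N => L.1) (fun L => L.2)
      (fun u u' hu hu' => by
        obtain ⟨g, rfl⟩ := exists_linearEquiv_apply_eq (F := F) hu hu'
        exact ⟨grEquiv g, fun L => (mem_grEquiv g L u).symm⟩)
      (localPart ⊤ J.1)
    have hN : N * l = N * j + N * k + N * t := by rw [← h, mul_add, mul_add]
    rw [finrank_localPart_top, J.2, finrank_space, mul_comm j N, ← pow_add, hN,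
      pow_add _ (N * j + N * k), mul_left_comm] at key
    rw [Finset.sum_congr rfl fun L _ => by rw [localPart_eq_inf, inf_comm]]
    exact Nat.le_of_mul_le_mul_left key (by positivity)
  have hsum : ∀ L : Gr F l k N, finrank F (Chain L.1 j) =
      ∑ J : Parties l j, finrank F (localPart L.1 J.1) := fun L => finrank_submodule_pi _
  rw [Finset.sum_congr rfl fun L _ => hsum L]
  rw [Finset.sum_comm, Finset.sum_mul]
  refine (Finset.sum_le_card_nsmul _ _ _ fun J _ => hJ J).trans (le_of_eq ?_)
  rw [Finset.card_univ, card_parties, smul_eq_mul]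

/-- Dual to the chain estimate: the codimension of `V_J + L` is the dimension of the intersection of
the two annihilators, and the annihilator of `L` meets every nonzero functional equally often. -/
theorem sum_codim_mul_le [Fintype (Gr F l k N)] (hk : k ≤ l) {j t : ℕ} (h : j + k = l + t) :
    (∑ L : Gr F l k N, codim L.1 j) * Nat.card F ^ (N * t) ≤
      l.choose j * Fintype.card (Gr F l k N) := by
  have hq : 0 < Nat.card F := Nat.card_pos
  have hann : ∀ S : Submodule F (Space F l N), finrank F (S.dualAnnihilator) =
      N * l - finrank F S := fun S => by
    have := Subspace.finrank_add_finrank_dualAnnihilator_eq S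
    rw [finrank_space] at this
    omega
  have hJ : ∀ J : Parties l j,
      (∑ L : Gr F l k N, finrank F (Space F l N ⧸ (localPart ⊤ J.1 ⊔ L.1))) *
      Nat.card F ^ (N * t) ≤ Fintype.card (Gr F l k N) := by
    intro J
    have hj : j ≤ l := by
      have := Finset.card_le_univ J.1
      rwa [J.2, Fintype.card_fin] at this
    have key := sum_finrank_inf_mul_le (fun L : Gr F l k N => L.1.dualAnnihilator)
      (d := N * (l - k)) (fun L => by rw [hann, L.2, Nat.mul_sub])
      (fun f f' hf hf' => by
        obtain ⟨g, hg⟩ := exists_linearEquiv_comp_eq hf hf'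
        refine ⟨grEquiv g, fun L => ?_⟩
        rw [Submodule.mem_dualAnnihilator, Submodule.mem_dualAnnihilator]
        constructor
        · intro h w hw
          rw [← g.apply_symm_apply w, hg]
          apply h
          rwa [← mem_grEquiv g, g.apply_symm_apply]
        · intro h w hw
          rw [← hg]
          exact h _ ((mem_grEquiv g L w).2 hw))
      (localPart ⊤ J.1).dualAnnihilator
    rw [hann, finrank_localPart_top, J.2, Subspace.dual_finrank_eq, finrank_space,
      mul_comm j N, ← Nat.mul_sub, ← pow_add, ← mul_add] at key
    have hN : N * l = N * (l - j + (l - k)) + N * t := by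
      rw [← mul_add]
      congr 1
      omega
    rw [hN, pow_add, mul_left_comm] at key
    have hquot : ∀ L : Gr F l k N, finrank F (Space F l N ⧸ (localPart ⊤ J.1 ⊔ L.1)) =
        finrank F (L.1.dualAnnihilator ⊓ (localPart ⊤ J.1).dualAnnihilator :
          Submodule F (Dual F (Space F l N))) := fun L => by
      rw [← Submodule.dualAnnihilator_sup_eq, sup_comm, hann]
      have := Submodule.finrank_quotient_add_finrank (L.1 ⊔ localPart ⊤ J.1)
      rw [finrank_space] at this
      omega
    rw [Finset.sum_congr rfl fun L _ => hquot L]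
    exact Nat.le_of_mul_le_mul_left key (by positivity)
  simp only [codim]
  rw [Finset.sum_comm, Finset.sum_mul]
  refine (Finset.sum_le_card_nsmul _ _ _ fun J _ => hJ J).trans (le_of_eq ?_)
  rw [Finset.card_univ, card_parties, smul_eq_mul]

end Grassmannian

end StabilizerHomology

namespace StabilizerHomology

open Module Filter

/-! ### Markov's inequality. -/

section Markov

variable {F : Type*} [Field F] {l k N : ℕ}

theorem prob_nonneg (A : Set (Gr F l k N)) : 0 ≤ prob A := by
  unfold prob
  positivity

/-- Markov's inequality for the uniform probability on the Grassmannian. -/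
theorem prob_le_of_sum_le [Fintype (Gr F l k N)] (A : Set (Gr F l k N)) (X : Gr F l k N → ℝ)
    (hX : ∀ L, 0 ≤ X L) {a c : ℝ} (ha : 0 < a) (hc : 0 ≤ c) (hA : ∀ L ∈ A, a ≤ X L)
    (hsum : ∑ L, X L ≤ c * Fintype.card (Gr F l k N)) : prob A ≤ c / a := by
  classical
  unfold prob
  rw [Nat.card_eq_fintype_card (α := Gr F l k N), Nat.card_eq_fintype_card,
    ← Set.toFinset_card]
  refine div_le_of_le_mul₀ (by positivity) (by positivity) ?_
  rw [div_mul_eq_mul_div, le_div_iff₀ ha]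
  calc (A.toFinset.card : ℝ) * a = ∑ _L ∈ A.toFinset, a := by rw [Finset.sum_const, nsmul_eq_mul]
    _ ≤ ∑ L ∈ A.toFinset, X L := Finset.sum_le_sum fun L hL => hA L (Set.mem_toFinset.1 hL)
    _ ≤ ∑ L, X L := Finset.sum_le_univ_sum_of_nonneg hX
    _ ≤ _ := hsum

end Markov

/-! ### From mean bounds to limits of probabilities. -/

section Limits

variable {F : Type*} [Field F] [Finite F] {l k : ℕ}

theorem tendsto_prob_of_bounded_mean (A : ∀ N, Set (Gr F l k N)) (X : ∀ N, Gr F l k N → ℕ)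
    (c : ℕ) {ε : ℝ} (hε : 0 < ε) (hA : ∀ N, 0 < N → ∀ L ∈ A N, ε ≤ 1 / (N : ℝ) * X N L)
    (hsum : ∀ N [Fintype (Gr F l k N)], ∑ L, X N L ≤ c * Fintype.card (Gr F l k N)) :
    Tendsto (fun N => prob (A N)) atTop (nhds 0) := by
  have hlim : Tendsto (fun N : ℕ => (c : ℝ) / (ε * N)) atTop (nhds 0) :=
    Tendsto.div_atTop tendsto_const_nhds (tendsto_natCast_atTop_atTop.const_mul_atTop hε)
  refine tendsto_of_tendsto_of_tendsto_of_le_of_le' tendsto_const_nhds hlim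
    (Eventually.of_forall fun N => prob_nonneg _) ?_
  filter_upwards [eventually_gt_atTop 0] with N hN
  have := Fintype.ofFinite (Gr F l k N)
  have hN' : (0 : ℝ) < N := Nat.cast_pos.2 hN
  refine prob_le_of_sum_le (A N) (fun L => (X N L : ℝ)) (fun _ => Nat.cast_nonneg _)
    (by positivity) (by positivity) (fun L hL => ?_) (by exact_mod_cast hsum N)
  have h := hA N hN L hL
  rw [one_div_mul_eq_div, le_div_iff₀ hN'] at h
  exact h

theorem tendsto_prob_of_exponential_mean (A : ∀ N, Set (Gr F l k N)) (X : ∀ N, Gr F l k N → ℕ)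
    (c t : ℕ) (ht : 0 < t) (hA : ∀ N, ∀ L ∈ A N, 1 ≤ X N L)
    (hsum : ∀ N [Fintype (Gr F l k N)],
      (∑ L, X N L) * Nat.card F ^ (N * t) ≤ c * Fintype.card (Gr F l k N)) :
    Tendsto (fun N => prob (A N)) atTop (nhds 0) := by
  have hq : 1 < (Nat.card F : ℝ) := by exact_mod_cast (Finite.one_lt_card : 1 < Nat.card F)
  have hlim : Tendsto (fun N : ℕ => (c : ℝ) / (Nat.card F : ℝ) ^ N) atTop (nhds 0) :=
    Tendsto.div_atTop tendsto_const_nhds (tendsto_pow_atTop_atTop_of_one_lt hq)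
  refine tendsto_of_tendsto_of_tendsto_of_le_of_le tendsto_const_nhds hlim
    (fun N => prob_nonneg _) fun N => ?_
  have := Fintype.ofFinite (Gr F l k N)
  have hqN : 0 < (Nat.card F : ℝ) ^ N := by positivity
  have hle : (∑ L, X N L) * Nat.card F ^ N ≤ c * Fintype.card (Gr F l k N) :=
    (Nat.mul_le_mul_left _ (Nat.pow_le_pow_right Nat.card_pos
      (Nat.le_mul_of_pos_right N ht))).trans (hsum N)
  have h := prob_le_of_sum_le (A N) (fun L => (X N L : ℝ)) (fun _ => Nat.cast_nonneg _)
    (a := 1) (c := c / (Nat.card F : ℝ) ^ N) one_pos (by positivity)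
    (fun L hL => by exact_mod_cast hA N L hL) (by
      rw [div_mul_eq_mul_div, le_div_iff₀ hqN]
      exact_mod_cast hle)
  rwa [div_one] at h

theorem sum_finrank_chain_le {N : ℕ} [Fintype (Gr F l k N)] {j : ℕ} (h : j + k ≤ l) :
    ∑ L : Gr F l k N, finrank F (Chain L.1 j) ≤ l.choose j * Fintype.card (Gr F l k N) :=
  (Nat.le_mul_of_pos_right _ (pow_pos Nat.card_pos _)).trans
    (sum_finrank_chain_mul_le (t := l - (j + k)) (by omega))

theorem sum_codim_le {N : ℕ} [Fintype (Gr F l k N)] (hk : k ≤ l) {j : ℕ} (h : l ≤ j + k) :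
    ∑ L : Gr F l k N, codim L.1 j ≤ l.choose j * Fintype.card (Gr F l k N) :=
  (Nat.le_mul_of_pos_right _ (pow_pos Nat.card_pos _)).trans
    (sum_codim_mul_le (t := j + k - l) hk (by omega))

theorem sum_finrank_chain_add_codim_le {N : ℕ} [Fintype (Gr F l k N)] (hk : k ≤ l) :
    ∑ L : Gr F l k N, (finrank F (Chain L.1 (l - k)) + codim L.1 (l - k)) ≤
      (2 * l.choose (l - k)) * Fintype.card (Gr F l k N) := by
  rw [Finset.sum_add_distrib, two_mul, add_mul]
  exact Nat.add_le_add (sum_finrank_chain_le (by omega)) (sum_codim_le hk (by omega))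

end Limits

end StabilizerHomology

theorem theorem1 (F : Type*) [Field F] [Finite F] (l k : ℕ) (hl : 2 ≤ l) (hk : k ≤ l) :
    -- (1)
    (∀ j : ℕ, (j : ℤ) < (l : ℤ) - k →
      Filter.Tendsto (fun N : ℕ => StabilizerHomology.prob
        {L : StabilizerHomology.Gr F l k N | Nontrivial (StabilizerHomology.Chain L.1 j)})
        Filter.atTop (nhds 0)) ∧
    -- (2)
    (∀ j : ℕ, ((j : ℤ) < (l : ℤ) - k ∨ (l : ℤ) - k + 2 < (j : ℤ)) →
      Filter.Tendsto (fun N : ℕ => StabilizerHomology.prob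
        {L : StabilizerHomology.Gr F l k N | Nontrivial (StabilizerHomology.Homology L.1 j)})
        Filter.atTop (nhds 0)) ∧
    ∀ ε : ℝ, 0 < ε →
      -- (3)
      Filter.Tendsto (fun N : ℕ => StabilizerHomology.prob
        {L : StabilizerHomology.Gr F l k N |
          ε ≤ 1 / (N : ℝ) * Module.finrank F (StabilizerHomology.Chain L.1 (l - k))})
        Filter.atTop (nhds 0) ∧
      -- (4)
      Filter.Tendsto (fun N : ℕ => StabilizerHomology.prob
        {L : StabilizerHomology.Gr F l k N |
          ε ≤ 1 / (N : ℝ) * Module.finrank F (StabilizerHomology.Homology L.1 (l - k)) +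
            1 / (N : ℝ) * Module.finrank F (StabilizerHomology.Homology L.1 (l - k + 2))})
        Filter.atTop (nhds 0) ∧
      -- (5)
      (∀ j : ℕ, (j : ℤ) ≠ (l : ℤ) - k + 1 →
        Filter.Tendsto (fun N : ℕ => StabilizerHomology.prob
          {L : StabilizerHomology.Gr F l k N |
            ε ≤ 1 / (N : ℝ) * Module.finrank F (StabilizerHomology.Homology L.1 j)})
          Filter.atTop (nhds 0)) ∧
      Filter.Tendsto (fun N : ℕ => StabilizerHomology.prob
        {L : StabilizerHomology.Gr F l k N |
          ε ≤ |1 / (N : ℝ) * Module.finrank F (StabilizerHomology.Homology L.1 (l - k + 1)) -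
            StabilizerHomology.chi l k|})
        Filter.atTop (nhds 0) := by
  open StabilizerHomology Module in
  have hmono : ∀ {N a b : ℕ} {ε : ℝ}, a ≤ b → ε ≤ 1 / (N : ℝ) * a → ε ≤ 1 / (N : ℝ) * b :=
    fun hab h => h.trans (mul_le_mul_of_nonneg_left (Nat.cast_le.2 hab) (by positivity))
  refine ⟨fun j hj => ?_, fun j hj => ?_, fun ε hε => ⟨?_, ?_, fun j hj => ?_, ?_⟩⟩
  · refine tendsto_prob_of_exponential_mean _ (fun N L => finrank F (Chain L.1 j)) (l.choose j)
      (l - (j + k)) (by omega) (fun N L hL => ?_)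
      fun N _ => sum_finrank_chain_mul_le (by omega)
    have : Nontrivial (Chain L.1 j) := hL
    exact finrank_pos
  · rcases hj with hj | hj
    · refine tendsto_prob_of_exponential_mean _ (fun N L => finrank F (Chain L.1 j)) (l.choose j)
        (l - (j + k)) (by omega) (fun N L hL => ?_)
        fun N _ => sum_finrank_chain_mul_le (by omega)
      have : Nontrivial (Homology L.1 j) := hL
      exact (finrank_pos (R := F)).trans_le (finrank_homology_le_chain L.1 j)
    -- Here `i > l - k`, so the mean of `codim L i` decays exponentially.
    · obtain ⟨i, rfl⟩ : ∃ i, j = i + 2 := ⟨j - 2, by omega⟩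
      refine tendsto_prob_of_exponential_mean _ (fun N L => codim L.1 i) (l.choose i)
        (i + k - l) (by omega) (fun N L hL => ?_)
        fun N _ => sum_codim_mul_le hk (by omega)
      have : Nontrivial (Homology L.1 (i + 2)) := hL
      exact (finrank_pos (R := F)).trans_le (finrank_homology_add_two_le hl L.1 i)
  · exact tendsto_prob_of_bounded_mean _ (fun N L => finrank F (Chain L.1 (l - k)))
      (l.choose (l - k)) hε (fun N hN L hL => hL) fun N _ => sum_finrank_chain_le (by omega)
  · refine tendsto_prob_of_bounded_mean _
      (fun N L => finrank F (Chain L.1 (l - k)) + codim L.1 (l - k))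
      (2 * l.choose (l - k)) hε (fun N hN L hL => ?_) fun N _ => sum_finrank_chain_add_codim_le hk
    rw [Set.mem_ofPred_eq, ← mul_add, ← Nat.cast_add] at hL
    exact hmono (Nat.add_le_add (finrank_homology_le_chain L.1 _)
      (finrank_homology_add_two_le hl L.1 _)) hL
  · rcases le_or_gt j (l - k) with h | h
    · exact tendsto_prob_of_bounded_mean _ (fun N L => finrank F (Chain L.1 j)) (l.choose j) hε
        (fun N hN L hL => hmono (finrank_homology_le_chain L.1 j) hL)
        fun N _ => sum_finrank_chain_le (by omega)
    · obtain ⟨i, rfl⟩ : ∃ i, j = i + 2 := ⟨j - 2, by omega⟩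
      exact tendsto_prob_of_bounded_mean _ (fun N L => codim L.1 i) (l.choose i) hε
        (fun N hN L hL => hmono (finrank_homology_add_two_le hl L.1 i) hL)
        fun N _ => sum_codim_le hk (by omega)
  · refine tendsto_prob_of_bounded_mean _
      (fun N L => finrank F (Chain L.1 (l - k)) + codim L.1 (l - k))
      (2 * l.choose (l - k)) hε (fun N hN L hL => ?_) fun N _ => sum_finrank_chain_add_codim_le hk
    rw [Set.mem_ofPred_eq] at hL
    obtain ⟨h1, h2⟩ := finrank_homology_middle hl hk L.1 L.2
    have hN' : (0 : ℝ) < N := Nat.cast_pos.2 hN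
    -- It remains to bound `|dim H - N χ_k|` by the sum of the two one-sided errors.
    refine hL.trans ?_
    rw [one_div_mul_eq_div, one_div_mul_eq_div, div_sub' hN'.ne', abs_div, abs_of_pos hN']
    refine div_le_div_of_nonneg_right ?_ hN'.le
    have h1' : (N : ℝ) * chi l k ≤ finrank F (Homology L.1 (l - k + 1)) +
      finrank F (Chain L.1 (l - k)) := by exact_mod_cast h1
    have h2' : (finrank F (Homology L.1 (l - k + 1)) : ℝ) ≤ N * chi l k +
      codim L.1 (l - k) := by exact_mod_cast h2
    have h3 : (0 : ℝ) ≤ finrank F (Chain L.1 (l - k)) := Nat.cast_nonneg _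
    have h4 : (0 : ℝ) ≤ codim L.1 (l - k) := Nat.cast_nonneg _
    push_cast
    rw [abs_le]
    constructor <;> linarith
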